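/- Let $n\ge 1$, $0<\alpha<2$, let $C_{n,\alpha}>0$ be a constant, and let $G\in C^1(\mathbb R)$ satisfy $G(0)=0$ and $G'(t)\ge c_0>0$ for all $t\in\mathbb R$. For $u:\mathbb R^n\to\mathbb R$ put $$F_\alpha(u(x))=C_{n,\alpha}\lim_{\epsilon\to0^+}\int_{\mathbb R^n\setminus B_\epsilon(x)}\frac{G(u(x)-u(z))}{|x-z|^{n+\alpha}}\,dz .$$ Let $f:\mathbb R\to\mathbb R$ be Lipschitz continuous. Let $B_1$ be the open unit ball centered at the origin and let $u\in L_\alpha\cap C^{1,1}_{loc}(B_1)$, where $L_\alpha=\{u\in L^1_{loc}(\mathbb R^n):\int_{\mathbb R^n}\frac{|u(x)|}{1+|x|^{n+\alpha}}\,dx<\infty\}$ and $C^{1,1}_{loc}(B_1)$ is the set of functions that are differentiable in $B_1$ with locally Lipschitz gradient there. Assume that $u$ is continuous on the closed ball $\overline{B_1}$, that $u>0$ in $B_1$, and that $u$ solves $$F_\alpha(u(x))=f(u(x))\quad\text{for } x\in B_1,\qquad u(x)=0\quad\text{for } x\notin B_1,$$ where the equation includes that the truncated integrals converge absolutely and that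 the limit defining $F_\alpha(u(x))$ exists. Then $u$ is radially symmetric and monotone decreasing about the origin: there is a function $\varphi:\mathbb R\to\mathbb R$ with $u(x)=\varphi(|x|)$ for all $x\in\mathbb R^n$, and $\varphi$ is strictly decreasing on $[0,1]$. -/

import Mathlib

open MeasureTheory Filter Topology

/-- The class `C^{1,1}_loc(Ω)` for an open set `Ω ⊆ ℝⁿ`: `u` is differentiable in `Ω` and its
derivative is locally Lipschitz in `Ω` (equivalently, Lipschitz on each compact subset of `Ω`). -/
def IsC11Loc {n : ℕ} (Ω : Set (EuclideanSpace ℝ (Fin n)))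
    (u : EuclideanSpace ℝ (Fin n) → ℝ) : Prop :=
  DifferentiableOn ℝ u Ω ∧ LocallyLipschitzOn Ω (fderiv ℝ u)

/-- The space `L_α`: locally integrable functions `u` on `ℝⁿ` with
`∫ |u(x)| / (1 + |x|^{n+α}) dx < ∞`. -/
def MemLAlpha {n : ℕ} (α : ℝ) (u : EuclideanSpace ℝ (Fin n) → ℝ) : Prop :=
  LocallyIntegrable u volume ∧
    Integrable (fun x => |u x| / (1 + ‖x‖ ^ ((n : ℝ) + α))) volume

/-- `HasFAlphaAt α C G u x l` says that `F_α(u(x))` is well defined and equal to `l`, where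
`F_α(u(x)) = C · lim_{ε → 0+} ∫_{ℝⁿ ∖ B_ε(x)} G(u(x) - u(z)) / |x - z|^{n+α} dz`:
all the truncated integrals converge absolutely and the limit exists and is `l`. -/
def HasFAlphaAt {n : ℕ} (α C : ℝ) (G : ℝ → ℝ) (u : EuclideanSpace ℝ (Fin n) → ℝ)
    (x : EuclideanSpace ℝ (Fin n)) (l : ℝ) : Prop :=
  (∀ ε : ℝ, 0 < ε →
    IntegrableOn (fun z => G (u x - u z) / ‖x - z‖ ^ ((n : ℝ) + α)) (Metric.ball x ε)ᶜ volume) ∧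
  Tendsto
    (fun ε : ℝ => C * ∫ z in (Metric.ball x ε)ᶜ, G (u x - u z) / ‖x - z‖ ^ ((n : ℝ) + α))
    (𝓝[>] 0) (𝓝 l)

/-! The proof moves planes directly on the integral operator. For a unit vector `e` and a level `t`,
let `w` be the difference between `u` at the mirror point and `u`, on the half-space below the
plane. Folding the difference of the two `F_α` integrals onto that half-space pairs each `y` with
its mirror image. At a nonpositive minimum of `w` every paired integrand is nonpositive, because `G'
≥ c₀` and `y` is nearer than its image. All but a chosen set `Q` can then be dropped
(`HasFAlphaAt.sub_le_setIntegral`). Two choices of `Q` suffice. A ball comparable to the distance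
`d` to the plane gives a bound of order `d ^ (-α) * w`. The Lipschitz bound on `f` contradicts this
for small `d`, so negative minima stay away from the plane (`exists_le_dist_of_neg_min`). A ball
where `w > 0` gives the strong maximum principle (`eq_of_touching`). Together they carry the plane
from `t = -1` to `t = 0`. Doing so in all directions gives symmetry, and strictness at `t < 0` gives
strict decrease. -/

/-! ### Geometry of hyperplane reflections. -/

section Reflection

variable {E : Type*} [NormedAddCommGroup E] [InnerProductSpace ℝ E]

/-- The reflection across the affine hyperplane `{x | ⟪e, x⟫ = t}`, for a unit vector `e`. -/
noncomputable def planeReflection (e : E) (t : ℝ) (x : E) : E :=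
  x + (2 * (t - inner ℝ e x)) • e

lemma inner_planeReflection {e : E} (he : ‖e‖ = 1) (t : ℝ) (x : E) :
    inner ℝ e (planeReflection e t x) = 2 * t - inner ℝ e x := by
  simp only [planeReflection, inner_add_right, inner_smul_right, real_inner_self_eq_norm_sq, he]
  ring

lemma planeReflection_involutive {e : E} (he : ‖e‖ = 1) (t : ℝ) :
    Function.Involutive (planeReflection e t) := by
  intro x
  rw [planeReflection, inner_planeReflection he, planeReflection, add_assoc, ← add_smul]
  convert add_zero x
  convert zero_smul ℝ e
  ring

lemma planeReflection_of_inner_eq {e : E} {t : ℝ} {x : E} (h : inner ℝ e x = t) :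
    planeReflection e t x = x := by
  simp [planeReflection, h]

lemma norm_planeReflection_sub {e : E} (he : ‖e‖ = 1) (t : ℝ) (x y : E) :
    ‖planeReflection e t x - planeReflection e t y‖ = ‖x - y‖ := by
  have h : planeReflection e t x - planeReflection e t y
      = (x - y) - (2 * inner ℝ e (x - y)) • e := by
    simp only [planeReflection, inner_sub_right]
    module
  rw [← sq_eq_sq₀ (norm_nonneg _) (norm_nonneg _), h, norm_sub_sq_real, inner_smul_right,
    norm_smul, he, real_inner_comm, mul_one, Real.norm_eq_abs, sq_abs]
  ring

/-- The correction is a product of signed distances to the plane, hence positive when both points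
lie strictly on the same side. All later distance comparisons come from this identity. -/
lemma norm_sub_planeReflection_sq {e : E} (he : ‖e‖ = 1) (t : ℝ) (x y : E) :
    ‖x - planeReflection e t y‖ ^ 2
      = ‖x - y‖ ^ 2 + 4 * (t - inner ℝ e x) * (t - inner ℝ e y) := by
  have h : x - planeReflection e t y = (x - y) - (2 * (t - inner ℝ e y)) • e := by
    simp only [planeReflection]
    module
  rw [h, norm_sub_sq_real, inner_smul_right, norm_smul, he, real_inner_comm e (x - y), mul_one,
    Real.norm_eq_abs, sq_abs, inner_sub_right]
  ring

lemma norm_planeReflection_sq {e : E} (he : ‖e‖ = 1) (t : ℝ) (x : E) :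
    ‖planeReflection e t x‖ ^ 2 = ‖x‖ ^ 2 + 4 * t * (t - inner ℝ e x) := by
  have h := norm_sub_planeReflection_sq he t 0 x
  simpa using h

lemma norm_sub_planeReflection_self {e : E} (he : ‖e‖ = 1) {t : ℝ} {x : E}
    (hx : inner ℝ e x ≤ t) : ‖x - planeReflection e t x‖ = 2 * (t - inner ℝ e x) := by
  rw [norm_sub_rev, planeReflection, add_sub_cancel_left, norm_smul, he, mul_one,
    Real.norm_of_nonneg (by linarith)]

lemma norm_sub_lt_norm_sub_planeReflection {e : E} (he : ‖e‖ = 1) {t : ℝ} {x y : E}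
    (hx : inner ℝ e x < t) (hy : inner ℝ e y < t) :
    ‖x - y‖ < ‖x - planeReflection e t y‖ := by
  rw [← sq_lt_sq₀ (norm_nonneg _) (norm_nonneg _), norm_sub_planeReflection_sq he]
  have := mul_pos (sub_pos.2 hx) (sub_pos.2 hy)
  linarith

lemma norm_planeReflection_le {e : E} (he : ‖e‖ = 1) {t : ℝ} (ht : t ≤ 0) {x : E}
    (hx : inner ℝ e x < t) : ‖planeReflection e t x‖ ≤ ‖x‖ := by
  rw [← sq_le_sq₀ (norm_nonneg _) (norm_nonneg _), norm_planeReflection_sq he]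
  have := mul_nonneg (neg_nonneg.2 ht) (sub_pos.2 hx).le
  linarith

lemma norm_planeReflection_lt {e : E} (he : ‖e‖ = 1) {t : ℝ} (ht : t < 0) {x : E}
    (hx : inner ℝ e x < t) : ‖planeReflection e t x‖ < ‖x‖ := by
  rw [← sq_lt_sq₀ (norm_nonneg _) (norm_nonneg _), norm_planeReflection_sq he]
  have := mul_pos (neg_pos.2 ht) (sub_pos.2 hx)
  linarith

lemma continuous_planeReflection_uncurry (e : E) :
    Continuous fun q : ℝ × E => planeReflection e q.1 q.2 := by
  unfold planeReflection
  fun_prop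

lemma continuous_planeReflection (e : E) (t : ℝ) : Continuous (planeReflection e t) := by
  unfold planeReflection
  fun_prop

lemma planeReflection_eq_reflection {e : E} (he : ‖e‖ = 1) (t : ℝ) :
    planeReflection e t = fun x => (ℝ ∙ e)ᗮ.reflection x + (2 * t) • e := by
  ext x
  rw [Submodule.reflection_orthogonal_apply, Submodule.reflection_singleton_apply, he]
  simp only [planeReflection]
  simp
  module

variable [MeasurableSpace E] [BorelSpace E]

lemma measurePreserving_planeReflection [FiniteDimensional ℝ E] {e : E} (he : ‖e‖ = 1) (t : ℝ) :
    MeasurePreserving (planeReflection e t) (volume : Measure E) volume := by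
  rw [planeReflection_eq_reflection he]
  exact (measurePreserving_add_right volume ((2 * t) • e)).comp
    ((ℝ ∙ e)ᗮ.reflection).measurePreserving

lemma measurableEmbedding_planeReflection {e : E} (he : ‖e‖ = 1) (t : ℝ) :
    MeasurableEmbedding (planeReflection e t) :=
  (Homeomorph.mk (planeReflection_involutive he t).toPerm (continuous_planeReflection e t)
    (continuous_planeReflection e t)).measurableEmbedding

end Reflection

/-- Absolute continuity of the integral. The condition `1 ≤ n` makes the volume of small balls tend
to zero. -/
lemma tendsto_setIntegral_ball_zero {n : ℕ} (hn : 1 ≤ n) {h : EuclideanSpace ℝ (Fin n) → ℝ}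
    {s : Set (EuclideanSpace ℝ (Fin n))} (hs : IntegrableOn h s)
    (x : EuclideanSpace ℝ (Fin n)) {r : ℝ} (hr : 0 < r) (hsub : Metric.ball x r ⊆ s) :
    Tendsto (fun ε : ℝ => ∫ y in Metric.ball x ε, h y) (𝓝[>] 0) (𝓝 0) := by
  have hvol : Tendsto (fun ε : ℝ => volume (Metric.ball x ε)) (𝓝[>] 0) (𝓝 0) := by
    have : Nonempty (Fin n) := ⟨⟨0, hn⟩⟩
    have hlim : Tendsto (fun ε : ℝ => ENNReal.ofReal (ε ^ n) *
        volume (Metric.ball (0 : EuclideanSpace ℝ (Fin n)) 1)) (𝓝[>] 0) (𝓝 0) := by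
      have h0 : Tendsto (fun ε : ℝ => ε ^ n) (𝓝[>] 0) (𝓝 0) := by
        have := (continuous_pow (M := ℝ) n).tendsto 0
        rw [zero_pow (by omega)] at this
        exact this.mono_left nhdsWithin_le_nhds
      have := ENNReal.Tendsto.mul_const (ENNReal.tendsto_ofReal h0)
        (b := volume (Metric.ball (0 : EuclideanSpace ℝ (Fin n)) 1))
        (Or.inr measure_ball_lt_top.ne)
      simpa using this
    refine hlim.congr' ?_
    filter_upwards [self_mem_nhdsWithin] with ε hε
    rw [Measure.addHaar_ball volume x (le_of_lt hε), finrank_euclideanSpace_fin]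
  have h1 : Tendsto (fun ε : ℝ => ∫ y in Metric.ball x ε, h y ∂(volume.restrict s)) (𝓝[>] 0)
      (𝓝 0) := by
    refine Integrable.tendsto_setIntegral_nhds_zero hs ?_
    exact tendsto_of_tendsto_of_tendsto_of_le_of_le tendsto_const_nhds hvol
      (fun _ => bot_le) (fun ε => Measure.restrict_apply_le _ _)
  refine h1.congr' ?_
  filter_upwards [Ioo_mem_nhdsGT hr] with ε hε
  rw [Measure.restrict_restrict Metric.isOpen_ball.measurableSet,
    Set.inter_eq_left.2 ((Metric.ball_subset_ball hε.2.le).trans hsub)]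

/-- The pointwise estimate behind the moving plane method at a nonpositive minimum. -/
lemma reflected_difference_le {G : ℝ → ℝ} {c₀ : ℝ} (hG : ∀ s t, s ≤ t → c₀ * (t - s) ≤ G t - G s)
    {a a' b b' k k' : ℝ} (hk' : 0 ≤ k') (hk : k' ≤ k) (ha : a' ≤ a) (hab : a' - a ≤ b' - b) :
    (G (a' - b') - G (a - b)) * k + (G (a' - b) - G (a - b')) * k'
      ≤ c₀ * ((a' - a) - (b' - b)) * (k - k') + 2 * c₀ * (a' - a) * k' := by
  -- Write `k = (k - k') + k'`. Minimality controls the `k - k'` part; in the `k'` part the four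
  -- values regroup into two pairs, one sharing `b'` and one sharing `b`, each at most `c₀ * (a' -
  -- a)`.
  have h1 := hG (a' - b') (a - b) (by linarith)
  have h2 := hG (a' - b') (a - b') (by linarith)
  have h3 := hG (a' - b) (a - b) (by linarith)
  have h4 := mul_le_mul_of_nonneg_right h1 (sub_nonneg.2 hk)
  have h5 := mul_le_mul_of_nonneg_right h2 hk'
  have h6 := mul_le_mul_of_nonneg_right h3 hk'
  linarith

/-! ### Folding the operator difference onto a half-space. -/

section Kernel

variable {n : ℕ} {α C : ℝ} {G : ℝ → ℝ} {u : EuclideanSpace ℝ (Fin n) → ℝ}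
  {e x : EuclideanSpace ℝ (Fin n)} {t : ℝ}

/-- The integrand of the difference `F_α(u(xᵗ)) - F_α(u(x))`, after reflecting the first integral
to be centred at `x`. -/
noncomputable def reflectedDiff (α : ℝ) (G : ℝ → ℝ) (u : EuclideanSpace ℝ (Fin n) → ℝ)
    (e : EuclideanSpace ℝ (Fin n)) (t : ℝ) (x y : EuclideanSpace ℝ (Fin n)) : ℝ :=
  (G (u (planeReflection e t x) - u (planeReflection e t y)) - G (u x - u y)) /
    ‖x - y‖ ^ ((n : ℝ) + α)

/-- `reflectedDiff` symmetrized with respect to the hyperplane. -/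
noncomputable def symmReflectedDiff (α : ℝ) (G : ℝ → ℝ) (u : EuclideanSpace ℝ (Fin n) → ℝ)
    (e : EuclideanSpace ℝ (Fin n)) (t : ℝ) (x y : EuclideanSpace ℝ (Fin n)) : ℝ :=
  reflectedDiff α G u e t x y + reflectedDiff α G u e t x (planeReflection e t y)

/-- Both terms on the right are nonpositive when `c₀ > 0`. The second drives the narrow region
principle; the first drives the strong maximum principle, where the second vanishes. -/
lemma symmReflectedDiff_le (hα : 0 < α) {c₀ : ℝ}
    (hG : ∀ s r, s ≤ r → c₀ * (r - s) ≤ G r - G s) (he : ‖e‖ = 1)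
    {y : EuclideanSpace ℝ (Fin n)} (hx : inner ℝ e x < t) (hy : inner ℝ e y < t) (hxy : y ≠ x)
    (hw : u (planeReflection e t x) ≤ u x)
    (hmin : u (planeReflection e t x) - u x ≤ u (planeReflection e t y) - u y) :
    symmReflectedDiff α G u e t x y ≤
      c₀ * ((u (planeReflection e t x) - u x) - (u (planeReflection e t y) - u y)) *
        ((‖x - y‖ ^ ((n : ℝ) + α))⁻¹ - (‖x - planeReflection e t y‖ ^ ((n : ℝ) + α))⁻¹) +
      2 * c₀ * (u (planeReflection e t x) - u x) *
        (‖x - planeReflection e t y‖ ^ ((n : ℝ) + α))⁻¹ := by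
  have hpos : 0 < ‖x - y‖ := norm_pos_iff.2 (sub_ne_zero.2 hxy.symm)
  have hlt := norm_sub_lt_norm_sub_planeReflection he hx hy
  have hk : (‖x - planeReflection e t y‖ ^ ((n : ℝ) + α))⁻¹ ≤ (‖x - y‖ ^ ((n : ℝ) + α))⁻¹ := by
    gcongr
  have := reflected_difference_le hG (by positivity) hk hw hmin
  simpa [symmReflectedDiff, reflectedDiff, planeReflection_involutive he t y, div_eq_mul_inv]
    using this

lemma symmReflectedDiff_nonpos (hα : 0 < α) {c₀ : ℝ} (hc₀ : 0 < c₀)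
    (hG : ∀ s r, s ≤ r → c₀ * (r - s) ≤ G r - G s) (he : ‖e‖ = 1)
    {y : EuclideanSpace ℝ (Fin n)} (hx : inner ℝ e x < t) (hy : inner ℝ e y < t) (hxy : y ≠ x)
    (hw : u (planeReflection e t x) ≤ u x)
    (hmin : u (planeReflection e t x) - u x ≤ u (planeReflection e t y) - u y) :
    symmReflectedDiff α G u e t x y ≤ 0 := by
  refine (symmReflectedDiff_le hα hG he hx hy hxy hw hmin).trans ?_
  have hpos : 0 < ‖x - y‖ := norm_pos_iff.2 (sub_ne_zero.2 hxy.symm)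
  have hlt := norm_sub_lt_norm_sub_planeReflection he hx hy
  have hk : (‖x - planeReflection e t y‖ ^ ((n : ℝ) + α))⁻¹ ≤ (‖x - y‖ ^ ((n : ℝ) + α))⁻¹ := by
    gcongr
  refine add_nonpos (mul_nonpos_of_nonpos_of_nonneg
    (mul_nonpos_of_nonneg_of_nonpos hc₀.le (by linarith)) (sub_nonneg.2 hk)) ?_
  exact mul_nonpos_of_nonpos_of_nonneg
    (mul_nonpos_of_nonneg_of_nonpos (by positivity) (by linarith)) (by positivity)

lemma planeReflection_preimage_compl_ball (he : ‖e‖ = 1) (ε : ℝ) :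
    planeReflection e t ⁻¹' (Metric.ball (planeReflection e t x) ε)ᶜ = (Metric.ball x ε)ᶜ := by
  ext y
  simp [dist_eq_norm, norm_planeReflection_sub he]

/-- The reflection is an isometry matching the truncations at `x` and at its image, so both singular
integrals can be cut at the same `ε` and subtracted. -/
lemma HasFAlphaAt.integrableOn_reflectedDiff {l l' : ℝ} (he : ‖e‖ = 1)
    (h : HasFAlphaAt α C G u x l) (h' : HasFAlphaAt α C G u (planeReflection e t x) l')
    {ε : ℝ} (hε : 0 < ε) :
    IntegrableOn (reflectedDiff α G u e t x) (Metric.ball x ε)ᶜ ∧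
    ∫ y in (Metric.ball x ε)ᶜ, reflectedDiff α G u e t x y =
      (∫ z in (Metric.ball (planeReflection e t x) ε)ᶜ,
        G (u (planeReflection e t x) - u z) / ‖planeReflection e t x - z‖ ^ ((n : ℝ) + α)) -
      ∫ z in (Metric.ball x ε)ᶜ, G (u x - u z) / ‖x - z‖ ^ ((n : ℝ) + α) := by
  have hmp := measurePreserving_planeReflection (E := EuclideanSpace ℝ (Fin n)) he t
  have hme := measurableEmbedding_planeReflection (E := EuclideanSpace ℝ (Fin n)) he t
  have hi := (hmp.integrableOn_comp_preimage hme).2 (h'.1 ε hε)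
  have heq := hmp.setIntegral_preimage_emb hme (fun z =>
    G (u (planeReflection e t x) - u z) / ‖planeReflection e t x - z‖ ^ ((n : ℝ) + α))
    (Metric.ball (planeReflection e t x) ε)ᶜ
  rw [planeReflection_preimage_compl_ball he] at hi heq
  simp only [Function.comp_def, norm_planeReflection_sub he] at hi heq
  have hd : reflectedDiff α G u e t x = fun y =>
      G (u (planeReflection e t x) - u (planeReflection e t y)) / ‖x - y‖ ^ ((n : ℝ) + α) -
      G (u x - u y) / ‖x - y‖ ^ ((n : ℝ) + α) := by
    ext y
    rw [reflectedDiff, sub_div]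
  rw [hd, ← heq]
  exact ⟨hi.sub (h.1 ε hε), integral_sub hi (h.1 ε hε)⟩

lemma ball_subset_halfSpace (he : ‖e‖ = 1) :
    Metric.ball x (t - inner ℝ e x) ⊆ {y | inner ℝ e y < t} := by
  intro y hy
  rw [mem_ball_iff_norm] at hy
  have h := (real_inner_le_norm e (y - x)).trans_eq (by rw [he, one_mul])
  rw [inner_sub_right] at h
  simp only [Set.mem_ofPred_eq]
  linarith

/-- The far side avoids a ball about `x`, so its folded contribution needs no truncation. -/
lemma HasFAlphaAt.integrableOn_reflectedDiff_comp {l l' : ℝ} (he : ‖e‖ = 1)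
    (hx : inner ℝ e x < t)
    (h : HasFAlphaAt α C G u x l) (h' : HasFAlphaAt α C G u (planeReflection e t x) l') :
    IntegrableOn (fun y => reflectedDiff α G u e t x (planeReflection e t y))
      {y | inner ℝ e y ≤ t} ∧
    ∫ y in {y | inner ℝ e y ≤ t}, reflectedDiff α G u e t x (planeReflection e t y) =
      ∫ y in {y | inner ℝ e y < t}ᶜ, reflectedDiff α G u e t x y := by
  have hmp := measurePreserving_planeReflection (E := EuclideanSpace ℝ (Fin n)) he t
  have hme := measurableEmbedding_planeReflection (E := EuclideanSpace ℝ (Fin n)) he t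
  have hpre : planeReflection e t ⁻¹' {y | inner ℝ e y < t}ᶜ = {y | inner ℝ e y ≤ t} := by
    ext y
    simp only [Set.mem_preimage, Set.mem_compl_iff, Set.mem_ofPred_eq, inner_planeReflection he]
    constructor <;> intro <;> linarith
  have hi := (h.integrableOn_reflectedDiff he h' (sub_pos.2 hx)).1.mono_set
    (Set.compl_subset_compl.2 (ball_subset_halfSpace he))
  have hi' := (hmp.integrableOn_comp_preimage hme).2 hi
  have heq := hmp.setIntegral_preimage_emb hme (reflectedDiff α G u e t x) {y | inner ℝ e y < t}ᶜ
  rw [hpre] at hi' heq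
  exact ⟨hi', heq⟩

/-- At a nonpositive minimum `x` of `w(y) = u(yᵗ) - u(y)` over the half-space `{y | ⟪e, y⟫ < t}`,
the difference of the values of `F_α` is at most the contribution of any part of the half-space
away from `x`. -/
theorem HasFAlphaAt.sub_le_setIntegral {l l' c₀ : ℝ} (hn : 1 ≤ n) (hα : 0 < α) (hC : 0 < C)
    (hc₀ : 0 < c₀) (hG : ∀ s r, s ≤ r → c₀ * (r - s) ≤ G r - G s) (he : ‖e‖ = 1)
    (hx : inner ℝ e x < t)
    (h : HasFAlphaAt α C G u x l) (h' : HasFAlphaAt α C G u (planeReflection e t x) l')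
    (hw : u (planeReflection e t x) ≤ u x)
    (hmin : ∀ y, inner ℝ e y < t →
      u (planeReflection e t x) - u x ≤ u (planeReflection e t y) - u y)
    {Q : Set (EuclideanSpace ℝ (Fin n))} {r : ℝ} (hr : 0 < r)
    (hQ : Q ⊆ {y | inner ℝ e y < t}) (hQr : Disjoint Q (Metric.ball x r)) :
    IntegrableOn (symmReflectedDiff α G u e t x) Q ∧
    l' - l ≤ C * ∫ y in Q, symmReflectedDiff α G u e t x y := by
  set S : Set (EuclideanSpace ℝ (Fin n)) := {y | inner ℝ e y < t} with hS
  have hcont : Continuous fun y : EuclideanSpace ℝ (Fin n) => inner ℝ e y := by fun_prop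
  have hSm : MeasurableSet S := (isOpen_lt hcont continuous_const).measurableSet
  have hTm : MeasurableSet {y : EuclideanSpace ℝ (Fin n) | inner ℝ e y = t} :=
    (isClosed_eq hcont continuous_const).measurableSet
  have hBm : ∀ ε, MeasurableSet (Metric.ball x ε) := fun ε => Metric.isOpen_ball.measurableSet
  obtain ⟨hci, hceq⟩ := h.integrableOn_reflectedDiff_comp he hx h'
  have hciS := hci.mono_set (show S ⊆ {y | inner ℝ e y ≤ t} from fun y (hy : inner ℝ e y < t) => le_of_lt hy)
  have hciT := hci.mono_set (show {y | inner ℝ e y = t} ⊆ {y | inner ℝ e y ≤ t} from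
    fun y (hy : inner ℝ e y = t) => le_of_eq hy)
  have hgi : ∀ ε, 0 < ε → IntegrableOn (reflectedDiff α G u e t x) (S \ Metric.ball x ε) :=
    fun ε hε => (h.integrableOn_reflectedDiff he h' hε).1.mono_set fun y hy => hy.2
  have hsi : ∀ ε, 0 < ε → IntegrableOn (symmReflectedDiff α G u e t x) (S \ Metric.ball x ε) :=
    fun ε hε => (hgi ε hε).add (hciS.mono_set Set.sdiff_subset)
  have hsub := ball_subset_halfSpace (x := x) (t := t) he
  have hmem : ∀ ε, 0 < ε → ∀ y ∈ S \ Metric.ball x ε, symmReflectedDiff α G u e t x y ≤ 0 := by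
    intro ε hε y hy
    refine symmReflectedDiff_nonpos hα hc₀ hG he hx hy.1 ?_ hw (hmin y hy.1)
    rintro rfl
    exact hy.2 (Metric.mem_ball_self hε)
  have hQS : ∀ ε, ε ≤ r → Q ⊆ S \ Metric.ball x ε := fun ε hε y hy =>
    ⟨hQ hy, fun hy' => Set.disjoint_left.1 hQr hy (Metric.ball_subset_ball hε hy')⟩
  refine ⟨(hsi r hr).mono_set (hQS r le_rfl), ?_⟩
  have hlim := h'.2.sub h.2
  -- The truncation removes a ball on the near side only, leaving the folded far term over that ball
  -- unpaired. This remainder vanishes as `ε → 0`.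
  have hlim2 := ((tendsto_setIntegral_ball_zero hn hciS x (sub_pos.2 hx) hsub).const_add
    (∫ y in Q, symmReflectedDiff α G u e t x y)).const_mul C
  rw [add_zero] at hlim2
  refine le_of_tendsto_of_tendsto hlim hlim2 ?_
  filter_upwards [Ioo_mem_nhdsGT (lt_min hr (sub_pos.2 hx))] with ε hε
  have hεr := hε.2.le.trans (min_le_left _ _)
  have hBS : Metric.ball x ε ⊆ S :=
    (Metric.ball_subset_ball (hε.2.le.trans (min_le_right _ _))).trans hsub
  obtain ⟨hdi, hdeq⟩ := h.integrableOn_reflectedDiff he h' hε.1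
  rw [← mul_sub, ← hdeq]
  refine mul_le_mul_of_nonneg_left ?_ hC.le
  have e1 : (Metric.ball x ε)ᶜ = (S \ Metric.ball x ε) ∪ Sᶜ := by
    ext y
    by_cases hy : y ∈ S
    · simp [hy]
    · simpa [hy] using not_lt.1 fun hy' => hy (hBS hy')
  have e2 : {y : EuclideanSpace ℝ (Fin n) | inner ℝ e y ≤ t} = S ∪ {y | inner ℝ e y = t} := by
    ext y
    simp [hS, le_iff_lt_or_eq]
  have d2 : Disjoint S {y : EuclideanSpace ℝ (Fin n) | inner ℝ e y = t} :=
    Set.disjoint_left.2 fun y hy hy' => (ne_of_lt hy) hy'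
  rw [e1, setIntegral_union (disjoint_compl_right.mono_left Set.sdiff_subset) hSm.compl
    (hgi ε hε.1) (hdi.mono_set (Set.compl_subset_compl.2 hBS)), ← hceq, e2,
    setIntegral_union d2 hTm hciS hciT]
  have hT : ∫ y in {y | inner ℝ e y = t},
      reflectedDiff α G u e t x (planeReflection e t y) ≤ 0 := by
    refine setIntegral_nonpos hTm fun y hy => ?_
    rw [planeReflection_of_inner_eq hy, reflectedDiff, planeReflection_of_inner_eq hy]
    have h1 := hG (u (planeReflection e t x) - u y) (u x - u y) (by linarith)
    have h2 : 0 ≤ c₀ * ((u x - u y) - (u (planeReflection e t x) - u y)) :=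
      mul_nonneg hc₀.le (by linarith)
    exact div_nonpos_of_nonpos_of_nonneg (by linarith) (by positivity)
  have hsplit : ∫ y in S, reflectedDiff α G u e t x (planeReflection e t y) =
      (∫ y in S \ Metric.ball x ε, reflectedDiff α G u e t x (planeReflection e t y)) +
      ∫ y in Metric.ball x ε, reflectedDiff α G u e t x (planeReflection e t y) := by
    rw [← setIntegral_union Set.disjoint_sdiff_left (hBm ε) (hciS.mono_set Set.sdiff_subset)
      (hciS.mono_set hBS), Set.sdiff_union_of_subset hBS]
  have hadd : ∫ y in S \ Metric.ball x ε, symmReflectedDiff α G u e t x y =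
      (∫ y in S \ Metric.ball x ε, reflectedDiff α G u e t x y) +
      ∫ y in S \ Metric.ball x ε, reflectedDiff α G u e t x (planeReflection e t y) :=
    integral_add (hgi ε hε.1) (hciS.mono_set Set.sdiff_subset)
  -- The integrand is nonpositive, so shrinking the domain to `Q` increases the integral.
  have hmono : ∫ y in S \ Metric.ball x ε, symmReflectedDiff α G u e t x y ≤
      ∫ y in Q, symmReflectedDiff α G u e t x y := by
    have := setIntegral_mono_set (hsi ε hε.1).neg
      ((ae_restrict_iff' (hSm.diff (hBm ε))).2 (ae_of_all _ fun y hy => by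
        simpa using hmem ε hε.1 y hy)) (LE.le.eventuallyLE (hQS ε hεr))
    simp only [Pi.neg_apply, integral_neg] at this
    linarith
  linarith

end Kernel

/-! ### Maximum principles from two choices of `Q`. -/

section MaximumPrinciples

variable {n : ℕ} {α C : ℝ} {G : ℝ → ℝ} {u : EuclideanSpace ℝ (Fin n) → ℝ}

/-- Narrow region principle: a negative minimum of `w(y) = u(yᵗ) - u(y)` stays away from the
reflecting hyperplane. -/
theorem exists_le_dist_of_neg_min {c₀ K : ℝ} (hn : 1 ≤ n) (hα : 0 < α) (hC : 0 < C)
    (hc₀ : 0 < c₀) (hG : ∀ s r, s ≤ r → c₀ * (r - s) ≤ G r - G s) (hK : 0 ≤ K) :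
    ∃ δ : ℝ, 0 < δ ∧ ∀ (e x : EuclideanSpace ℝ (Fin n)) (t l l' : ℝ), ‖e‖ = 1 → inner ℝ e x < t →
      HasFAlphaAt α C G u x l → HasFAlphaAt α C G u (planeReflection e t x) l' →
      u (planeReflection e t x) < u x →
      (∀ y, inner ℝ e y < t →
        u (planeReflection e t x) - u x ≤ u (planeReflection e t y) - u y) →
      K * (u (planeReflection e t x) - u x) ≤ l' - l → δ ≤ t - inner ℝ e x := by
  set ω : ℝ := volume.real (Metric.ball (0 : EuclideanSpace ℝ (Fin n)) 1) with hω
  have hωpos : 0 < ω := ENNReal.toReal_pos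
    (Metric.measure_ball_pos volume _ one_pos).ne' measure_ball_lt_top.ne
  set κ : ℝ := C * (2 * c₀) * ω * (1 / 2) ^ n / 4 ^ ((n : ℝ) + α) with hκ
  have hκpos : 0 < κ := by positivity
  -- The estimate will give `κ ≤ K * d ^ α`; `K + 1` avoids dividing by zero when `K = 0`.
  refine ⟨(κ / (K + 1)) ^ (1 / α), by positivity, ?_⟩
  intro e x t l l' he hx h h' hw hmin hle
  set d : ℝ := t - inner ℝ e x with hd
  have hdpos : 0 < d := sub_pos.2 hx
  -- Pushed away from the plane by `d`, this ball stays in the half-space and off `x`, while its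
  -- mirror image is within `2 * d + 3 / 2 * d ≤ 4 * d` of `x`.
  set Q := Metric.ball (x - d • e) (d / 2) with hQdef
  have hnear : ∀ y ∈ Q, d / 2 ≤ ‖x - y‖ ∧ ‖x - y‖ ≤ 3 / 2 * d := by
    intro y hy
    rw [hQdef, mem_ball_iff_norm] at hy
    have hde : ‖d • e‖ = d := by rw [norm_smul, he, mul_one, Real.norm_of_nonneg hdpos.le]
    have e1 : x - y = d • e - (y - (x - d • e)) := by abel
    have h1 := norm_sub_norm_le (d • e) (y - (x - d • e))
    have h2 := norm_sub_le (d • e) (y - (x - d • e))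
    rw [← e1, hde] at h1 h2
    constructor <;> linarith
  have hQS : Q ⊆ {y | inner ℝ e y < t} := by
    intro y hy
    rw [hQdef, mem_ball_iff_norm] at hy
    have h1 := (real_inner_le_norm e (y - (x - d • e))).trans_eq (by rw [he, one_mul])
    rw [inner_sub_right, inner_sub_right, inner_smul_right, real_inner_self_eq_norm_sq, he] at h1
    simp only [Set.mem_ofPred_eq]
    linarith
  have hQr : Disjoint Q (Metric.ball x (d / 2)) := by
    refine Set.disjoint_left.2 fun y hy hy' => ?_
    rw [mem_ball_iff_norm, norm_sub_rev] at hy'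
    linarith [(hnear y hy).1]
  obtain ⟨hint, hkey⟩ := h.sub_le_setIntegral hn hα hC hc₀ hG he hx h' hw.le hmin (half_pos hdpos)
    hQS hQr
  set w := u (planeReflection e t x) - u x with hwdef
  have hwneg : w < 0 := sub_neg.2 hw
  have hbound : ∀ y ∈ Q, symmReflectedDiff α G u e t x y ≤
      2 * c₀ * w * ((4 * d) ^ ((n : ℝ) + α))⁻¹ := by
    intro y hy
    have hy2 : inner ℝ e y < t := hQS hy
    obtain ⟨hy3, hy4⟩ := hnear y hy
    have hxy : y ≠ x := by
      rintro rfl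
      rw [sub_self, norm_zero] at hy3
      linarith
    refine (symmReflectedDiff_le hα hG he hx hy2 hxy hw.le (hmin y hy2)).trans ?_
    have hlt := norm_sub_lt_norm_sub_planeReflection he hx hy2
    have hxypos : 0 < ‖x - y‖ := by linarith
    have hk : (‖x - planeReflection e t y‖ ^ ((n : ℝ) + α))⁻¹ ≤ (‖x - y‖ ^ ((n : ℝ) + α))⁻¹ := by
      gcongr
    have hfar : ‖x - planeReflection e t y‖ ≤ 4 * d := by
      have h1 := norm_sub_le_norm_sub_add_norm_sub x (planeReflection e t x) (planeReflection e t y)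
      rw [norm_planeReflection_sub he, norm_sub_planeReflection_self he hx.le] at h1
      linarith
    have hk2 : ((4 * d) ^ ((n : ℝ) + α))⁻¹ ≤ (‖x - planeReflection e t y‖ ^ ((n : ℝ) + α))⁻¹ := by
      have : 0 < ‖x - planeReflection e t y‖ := hxypos.trans hlt
      gcongr
    have h1 : c₀ * (w - (u (planeReflection e t y) - u y)) *
        ((‖x - y‖ ^ ((n : ℝ) + α))⁻¹ - (‖x - planeReflection e t y‖ ^ ((n : ℝ) + α))⁻¹) ≤ 0 :=
      mul_nonpos_of_nonpos_of_nonneg (mul_nonpos_of_nonneg_of_nonpos hc₀.le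
        (sub_nonpos.2 (hmin y hy2))) (sub_nonneg.2 hk)
    have h2 := mul_le_mul_of_nonpos_left hk2
      (mul_nonpos_of_nonneg_of_nonpos (by positivity : 0 ≤ 2 * c₀) hwneg.le)
    linarith
  have hvol : volume.real Q = (d / 2) ^ n * ω := by
    rw [hQdef, Measure.real, Measure.addHaar_ball_of_pos volume _ (half_pos hdpos),
      finrank_euclideanSpace_fin, ENNReal.toReal_mul, ENNReal.toReal_ofReal (by positivity)]
    rfl
  have hI : ∫ y in Q, symmReflectedDiff α G u e t x y ≤
      (d / 2) ^ n * ω * (2 * c₀ * w * ((4 * d) ^ ((n : ℝ) + α))⁻¹) := by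
    refine (setIntegral_mono_on hint (integrableOn_const measure_ball_lt_top.ne)
      Metric.isOpen_ball.measurableSet hbound).trans_eq ?_
    rw [setIntegral_const, hvol, smul_eq_mul]
  have hpow : (4 * d) ^ ((n : ℝ) + α) = 4 ^ ((n : ℝ) + α) * (d ^ n * d ^ α) := by
    rw [Real.mul_rpow (by norm_num) hdpos.le, Real.rpow_add hdpos, Real.rpow_natCast]
  have hform : C * ((d / 2) ^ n * ω * (2 * c₀ * w * ((4 * d) ^ ((n : ℝ) + α))⁻¹)) =
      κ / d ^ α * w := by
    have hdα : 0 < d ^ α := by positivity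
    rw [hpow, hκ, div_pow, one_div, inv_pow]
    field_simp
  have h1 : K * w ≤ κ / d ^ α * w := by
    rw [← hform]
    exact hle.trans (hkey.trans (mul_le_mul_of_nonneg_left hI hC.le))
  have h2 : κ / d ^ α ≤ K := (mul_le_mul_right_of_neg hwneg).1 h1
  have hdα : 0 < d ^ α := by positivity
  rw [div_le_iff₀ hdα] at h2
  have h3 : κ / (K + 1) ≤ d ^ α := by
    rw [div_le_iff₀ (by positivity)]
    linarith
  calc (κ / (K + 1)) ^ (1 / α) ≤ (d ^ α) ^ (1 / α) := by gcongr
    _ = d := by rw [← Real.rpow_mul hdpos.le, mul_one_div_cancel hα.ne', Real.rpow_one]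

/-- Strong maximum principle: if `w(y) = u(yᵗ) - u(y)` is nonnegative on the half-space and
vanishes at a point where the values of `F_α` agree, then `w` vanishes on the half-space. -/
theorem eq_of_touching {c₀ l : ℝ} (hn : 1 ≤ n) (hα : 0 < α) (hC : 0 < C)
    (hc₀ : 0 < c₀) (hG : ∀ s r, s ≤ r → c₀ * (r - s) ≤ G r - G s) (hu : Continuous u)
    {e x : EuclideanSpace ℝ (Fin n)} {t : ℝ} (he : ‖e‖ = 1) (hx : inner ℝ e x < t)
    (h : HasFAlphaAt α C G u x l) (h' : HasFAlphaAt α C G u (planeReflection e t x) l)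
    (hw : u (planeReflection e t x) = u x)
    (hnonneg : ∀ y, inner ℝ e y < t → u y ≤ u (planeReflection e t y))
    {y : EuclideanSpace ℝ (Fin n)} (hy : inner ℝ e y < t) : u (planeReflection e t y) = u y := by
  by_contra hne
  have hypos : u y < u (planeReflection e t y) := lt_of_le_of_ne (hnonneg y hy) (Ne.symm hne)
  have hxy : y ≠ x := by
    rintro rfl
    exact hne hw
  have hcont := continuous_planeReflection e t
  have hinner : Continuous fun z : EuclideanSpace ℝ (Fin n) => inner ℝ e z := by fun_prop
  have hopen : IsOpen {z | inner ℝ e z < t ∧ u z < u (planeReflection e t z)} :=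
    IsOpen.and (isOpen_lt hinner continuous_const) (isOpen_lt hu (hu.comp hcont))
  obtain ⟨ρ, hρ, hsub⟩ := Metric.isOpen_iff.1 hopen y ⟨hy, hypos⟩
  set r := min ρ (dist y x / 2) with hr
  have hdpos : 0 < dist y x := dist_pos.2 hxy
  have hrpos : 0 < r := lt_min hρ (half_pos hdpos)
  have hQ : ∀ z ∈ Metric.ball y r, inner ℝ e z < t ∧ u z < u (planeReflection e t z) :=
    fun z hz => hsub (Metric.ball_subset_ball (min_le_left _ _) hz)
  have hdisj : Disjoint (Metric.ball y r) (Metric.ball x r) := by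
    refine Metric.ball_disjoint_ball ?_
    linarith [min_le_right ρ (dist y x / 2)]
  obtain ⟨hint, hkey⟩ := h.sub_le_setIntegral hn hα hC hc₀ hG he hx h' hw.le
    (fun z hz => by rw [hw, sub_self]; exact sub_nonneg.2 (hnonneg z hz)) hrpos
    (fun z hz => (hQ z hz).1) hdisj
  have hneg : ∀ z ∈ Metric.ball y r, symmReflectedDiff α G u e t x z < 0 := by
    intro z hz
    obtain ⟨hz1, hz2⟩ := hQ z hz
    have hzx : z ≠ x := by
      rintro rfl
      exact Set.disjoint_left.1 hdisj hz (Metric.mem_ball_self hrpos)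
    refine (symmReflectedDiff_le hα hG he hx hz1 hzx hw.le
      (by rw [hw, sub_self]; exact sub_nonneg.2 hz2.le)).trans_lt ?_
    have hpos : 0 < ‖x - z‖ := norm_pos_iff.2 (sub_ne_zero.2 hzx.symm)
    have hlt := norm_sub_lt_norm_sub_planeReflection he hx hz1
    have hk : (‖x - planeReflection e t z‖ ^ ((n : ℝ) + α))⁻¹ < (‖x - z‖ ^ ((n : ℝ) + α))⁻¹ := by
      gcongr
    rw [hw, sub_self, mul_zero, zero_mul, add_zero]
    exact mul_neg_of_neg_of_pos (mul_neg_of_pos_of_neg hc₀ (by linarith)) (sub_pos.2 hk)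
  -- Both operator values equal `l`, so `hkey` forces a nonnegative integral over the ball, against
  -- strict negativity.
  have hlt : 0 < ∫ z in Metric.ball y r, -symmReflectedDiff α G u e t x z := by
    refine (setIntegral_pos_iff_support_of_nonneg_ae
      (f := fun z => -symmReflectedDiff α G u e t x z) ((ae_restrict_iff' Metric.isOpen_ball.measurableSet).2
        (ae_of_all _ fun z hz => by simpa using (hneg z hz).le)) hint.neg).2 ?_
    have : Metric.ball y r ⊆ Function.support (fun z => -symmReflectedDiff α G u e t x z) :=
      fun z hz => by simpa using (hneg z hz).ne
    rw [Set.inter_eq_right.2 this]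
    exact Metric.measure_ball_pos volume y hrpos
  rw [integral_neg] at hlt
  have := mul_pos hC hlt
  linarith

end MaximumPrinciples

/-! ### The continuation argument and radial symmetry. -/

section MovingPlanes

variable {n : ℕ} {u : EuclideanSpace ℝ (Fin n) → ℝ}

lemma continuous_of_continuousOn_closedBall (hucont : ContinuousOn u (Metric.closedBall 0 1))
    (huout : ∀ x ∉ Metric.ball (0 : EuclideanSpace ℝ (Fin n)) 1, u x = 0) : Continuous u := by
  rw [← continuousOn_univ, show (Set.univ : Set (EuclideanSpace ℝ (Fin n))) =
    Metric.closedBall 0 1 ∪ (Metric.ball 0 1)ᶜ from (Set.eq_univ_of_forall fun x => by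
      by_cases hx : x ∈ Metric.ball (0 : EuclideanSpace ℝ (Fin n)) 1
      · exact Or.inl (Metric.ball_subset_closedBall hx)
      · exact Or.inr hx).symm]
  refine hucont.union_of_isClosed ?_ Metric.isClosed_closedBall Metric.isOpen_ball.isClosed_compl
  exact continuousOn_const.congr huout

/-- If `u(yᵗ) - u(y)` is negative somewhere on the half-space, then it attains a negative minimum
over the half-space at a point of the unit ball. -/
lemma exists_neg_min (hu : Continuous u) (hnn : ∀ x, 0 ≤ u x)
    (huout : ∀ x ∉ Metric.ball (0 : EuclideanSpace ℝ (Fin n)) 1, u x = 0)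
    {e y : EuclideanSpace ℝ (Fin n)} {t : ℝ} (hy : inner ℝ e y < t)
    (hyneg : u (planeReflection e t y) < u y) :
    ∃ x ∈ Metric.ball (0 : EuclideanSpace ℝ (Fin n)) 1, inner ℝ e x < t ∧
      u (planeReflection e t x) < u x ∧ ∀ z, inner ℝ e z < t →
        u (planeReflection e t x) - u x ≤ u (planeReflection e t z) - u z := by
  -- Negativity is confined to the ball, so a minimum over a compact set is global; it is off the
  -- plane, where the difference is zero.
  have hin : ∀ z, u (planeReflection e t z) < u z →
      z ∈ Metric.ball (0 : EuclideanSpace ℝ (Fin n)) 1 := by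
    intro z hz
    by_contra h
    rw [huout z h] at hz
    exact (hnn _).not_gt hz
  have hcomp : IsCompact (Metric.closedBall (0 : EuclideanSpace ℝ (Fin n)) 1 ∩
      {z | inner ℝ e z ≤ t}) :=
    (isCompact_closedBall _ _).inter_right (isClosed_le (by fun_prop) continuous_const)
  obtain ⟨x, hx, hmin⟩ := hcomp.exists_isMinOn
    ⟨y, Metric.ball_subset_closedBall (hin y hyneg), hy.le⟩
    ((hu.comp (continuous_planeReflection e t)).sub hu).continuousOn
  have hxy : u (planeReflection e t x) - u x ≤ u (planeReflection e t y) - u y :=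
    hmin ⟨Metric.ball_subset_closedBall (hin y hyneg), hy.le⟩
  have hxneg : u (planeReflection e t x) < u x := by linarith
  refine ⟨x, hin x hxneg, lt_of_le_of_ne hx.2 fun heq => ?_, hxneg, fun z hz => ?_⟩
  · rw [planeReflection_of_inner_eq heq] at hxneg
    exact lt_irrefl _ hxneg
  · by_cases hzn : u (planeReflection e t z) < u z
    · exact hmin ⟨Metric.ball_subset_closedBall (hin z hzn), hz.le⟩
    · linarith

/-- The planes can be moved up to the centre, provided that negative minima stay away from the
planes and that a nonnegative difference is positive on the closed ball. -/
theorem le_planeReflection_of_continuation (hu : Continuous u) (hnn : ∀ x, 0 ≤ u x)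
    (huout : ∀ x ∉ Metric.ball (0 : EuclideanSpace ℝ (Fin n)) 1, u x = 0)
    {e : EuclideanSpace ℝ (Fin n)} (he : ‖e‖ = 1) {δ : ℝ} (hδ : 0 < δ)
    (hnarrow : ∀ t ≤ 0, ∀ x ∈ Metric.ball (0 : EuclideanSpace ℝ (Fin n)) 1, inner ℝ e x < t →
      u (planeReflection e t x) < u x →
      (∀ z, inner ℝ e z < t →
        u (planeReflection e t x) - u x ≤ u (planeReflection e t z) - u z) →
      δ ≤ t - inner ℝ e x)
    (hstrong : ∀ t, -1 ≤ t → t < 0 →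
      (∀ z, inner ℝ e z < t → u z ≤ u (planeReflection e t z)) →
      ∀ x ∈ Metric.closedBall (0 : EuclideanSpace ℝ (Fin n)) 1, inner ℝ e x < t →
        u x < u (planeReflection e t x)) :
    ∀ t ∈ Set.Icc (-1 : ℝ) 0, ∀ z, inner ℝ e z < t → u z ≤ u (planeReflection e t z) := by
  have hrefl := continuous_planeReflection_uncurry e
  set A : Set ℝ := {t | ∀ z, inner ℝ e z < t → u z ≤ u (planeReflection e t z)} with hA
  suffices h : Set.Icc (-1 : ℝ) 0 ⊆ A from h
  have hAclosed : IsClosed A := by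
    have : A = ⋂ z, ({t | t ≤ inner ℝ e z} ∪ {t | u z ≤ u (planeReflection e t z)}) := by
      ext t
      simp only [hA, Set.mem_ofPred_eq, Set.mem_iInter, Set.mem_union, ← not_lt,
        imp_iff_not_or]
    rw [this]
    refine isClosed_iInter fun z => (isClosed_le continuous_id continuous_const).union
      (isClosed_le continuous_const (hu.comp (hrefl.comp (by fun_prop : Continuous fun t : ℝ =>
        (t, z)))))
  refine (hAclosed.inter isClosed_Icc).Icc_subset_of_forall_mem_nhdsWithin ?_ ?_
  -- At `t = -1` the half-space misses the ball.
  · intro z hz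
    have h1 := abs_real_inner_le_norm e z
    rw [he, one_mul] at h1
    have h2 := neg_abs_le (inner ℝ e z : ℝ)
    rw [huout z (by rw [mem_ball_zero_iff]; linarith)]
    exact hnn _
  · rintro t ⟨htA, ht⟩
    have hKcomp : IsCompact (Metric.closedBall (0 : EuclideanSpace ℝ (Fin n)) 1 ∩
        {z | inner ℝ e z ≤ t - δ / 2}) :=
      (isCompact_closedBall _ _).inter_right (isClosed_le (by fun_prop) continuous_const)
    -- By compactness, strict positivity at depth `δ / 2` survives a small move of the plane. For `s
    -- < t + δ / 2` a negative minimum has depth at least `δ` below `s`, so it would lie in this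
    -- region.
    have hev : ∀ᶠ s in 𝓝 t, ∀ z ∈ Metric.closedBall (0 : EuclideanSpace ℝ (Fin n)) 1 ∩
        {z | inner ℝ e z ≤ t - δ / 2}, u z < u (planeReflection e s z) := by
      refine hKcomp.eventually_forall_of_forall_eventually fun z hz => ?_
      have hz2 : inner ℝ e z ≤ t - δ / 2 := hz.2
      exact (isOpen_lt (hu.comp continuous_snd) (hu.comp hrefl)).mem_nhds
        (hstrong t ht.1 ht.2 htA z hz.1 (by linarith))
    filter_upwards [nhdsWithin_le_nhds hev,
      Ioo_mem_nhdsGT (lt_min ht.2 (by linarith : t < t + δ / 2))] with s hs hst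
    have hs0 : s ≤ 0 := hst.2.le.trans (min_le_left _ _)
    have hsδ : s ≤ t + δ / 2 := hst.2.le.trans (min_le_right _ _)
    intro z hz
    by_contra hneg
    obtain ⟨x, hxb, hx, hxneg, hmin⟩ := exists_neg_min hu hnn huout hz (not_le.1 hneg)
    have h1 := hnarrow s hs0 x hxb hx hxneg hmin
    have h2 : inner ℝ e x ≤ t - δ / 2 := by linarith
    exact lt_asymm hxneg (hs x ⟨Metric.ball_subset_closedBall hxb, h2⟩)

/-- A function that does not decrease under reflection towards the origin, in every direction,
is radially symmetric. -/
lemma eq_of_norm_eq_of_le_planeReflection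
    (h : ∀ e : EuclideanSpace ℝ (Fin n), ‖e‖ = 1 → ∀ z, inner ℝ e z < 0 →
      u z ≤ u (planeReflection e 0 z))
    {x y : EuclideanSpace ℝ (Fin n)} (hxy : ‖x‖ = ‖y‖) : u x = u y := by
  have key : ∀ a b : EuclideanSpace ℝ (Fin n), ‖a‖ = ‖b‖ → u a ≤ u b := by
    intro a b hab
    rcases eq_or_ne b a with rfl | hne
    · exact le_rfl
    -- As the norms agree, the perpendicular bisector of `a` and `b` passes through the origin, and
    -- reflection in it sends `a` to `b`.
    have hpos : 0 < ‖b - a‖ := norm_pos_iff.2 (sub_ne_zero.2 hne)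
    have he : ‖(‖b - a‖⁻¹ • (b - a))‖ = 1 := norm_smul_inv_norm (𝕜 := ℝ) (sub_ne_zero.2 hne)
    have hin : inner ℝ (b - a) a = -(‖b - a‖ ^ 2) / 2 := by
      have h1 := norm_sub_sq_real b a
      rw [inner_sub_left, real_inner_self_eq_norm_sq]
      rw [hab] at h1 ⊢
      linarith
    have hin2 : inner ℝ (‖b - a‖⁻¹ • (b - a)) a = -‖b - a‖ / 2 := by
      rw [real_inner_smul_left, hin]
      field_simp
    have hrefl : planeReflection (‖b - a‖⁻¹ • (b - a)) 0 a = b := by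
      rw [planeReflection, hin2, smul_smul,
        show 2 * (0 - -‖b - a‖ / 2) * ‖b - a‖⁻¹ = 1 by field_simp; ring, one_smul]
      abel
    have := h _ he a (by rw [hin2]; linarith)
    rwa [hrefl] at this
  exact le_antisymm (key x y hxy) (key y x hxy.symm)

end MovingPlanes

/-! ### Assembly of the main theorem. -/

theorem theorem3p1 (n : ℕ) (hn : 1 ≤ n) (α : ℝ) (hα0 : 0 < α) (hα2 : α < 2)
    (C : ℝ) (hC : 0 < C)
    (G : ℝ → ℝ) (hG : ContDiff ℝ 1 G) (hG0 : G 0 = 0)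
    (c₀ : ℝ) (hc₀ : 0 < c₀) (hG' : ∀ t : ℝ, c₀ ≤ deriv G t)
    (f : ℝ → ℝ) (hf : ∃ K : NNReal, LipschitzWith K f)
    (u : EuclideanSpace ℝ (Fin n) → ℝ)
    (huL : MemLAlpha α u)
    (huC : IsC11Loc (Metric.ball 0 1) u)
    (hucont : ContinuousOn u (Metric.closedBall 0 1))
    (hupos : ∀ x ∈ Metric.ball (0 : EuclideanSpace ℝ (Fin n)) 1, 0 < u x)
    (hueq : ∀ x ∈ Metric.ball (0 : EuclideanSpace ℝ (Fin n)) 1, HasFAlphaAt α C G u x (f (u x)))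
    (huout : ∀ x ∉ Metric.ball (0 : EuclideanSpace ℝ (Fin n)) 1, u x = 0) :
    ∃ φ : ℝ → ℝ, (∀ x, u x = φ ‖x‖) ∧ StrictAntiOn φ (Set.Icc 0 1) := by
  obtain ⟨K, hK⟩ := hf
  have hu := continuous_of_continuousOn_closedBall hucont huout
  have hnn : ∀ x, 0 ≤ u x := fun x => by
    by_cases hx : x ∈ Metric.ball (0 : EuclideanSpace ℝ (Fin n)) 1
    · exact (hupos x hx).le
    · exact (huout x hx).ge
  have hGinc : ∀ s r, s ≤ r → c₀ * (r - s) ≤ G r - G s := fun s r hsr =>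
    mul_sub_le_image_sub_of_le_deriv (hG.differentiable one_ne_zero) hG' hsr
  obtain ⟨δ, hδ, hδmin⟩ := exists_le_dist_of_neg_min (u := u) hn hα0 hC hc₀ hGinc K.coe_nonneg
  have hmem : ∀ {e x : EuclideanSpace ℝ (Fin n)} {t : ℝ}, ‖e‖ = 1 → t ≤ 0 → inner ℝ e x < t →
      x ∈ Metric.ball (0 : EuclideanSpace ℝ (Fin n)) 1 →
      planeReflection e t x ∈ Metric.ball (0 : EuclideanSpace ℝ (Fin n)) 1 := by
    intro e x t he ht hx hxb
    rw [mem_ball_zero_iff] at hxb ⊢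
    exact (norm_planeReflection_le he ht hx).trans_lt hxb
  have hstrong : ∀ e : EuclideanSpace ℝ (Fin n), ‖e‖ = 1 → ∀ t, -1 ≤ t → t < 0 →
      (∀ z, inner ℝ e z < t → u z ≤ u (planeReflection e t z)) →
      ∀ x ∈ Metric.closedBall (0 : EuclideanSpace ℝ (Fin n)) 1, inner ℝ e x < t →
        u x < u (planeReflection e t x) := by
    intro e he t ht1 ht0 hnonneg x hxb hx
    rw [mem_closedBall_zero_iff] at hxb
    rcases hxb.lt_or_eq with hx1 | hx1
    · refine lt_of_le_of_ne (hnonneg x hx) fun heq => ?_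
      have hxm : x ∈ Metric.ball (0 : EuclideanSpace ℝ (Fin n)) 1 := mem_ball_zero_iff.2 hx1
      have ht : -1 < t := by
        have h1 := abs_real_inner_le_norm e x
        rw [he, one_mul] at h1
        linarith [neg_abs_le (inner ℝ e x : ℝ)]
      -- The boundary point `-e` refutes equality: `u` vanishes there but is positive at its
      -- reflection, which is inside the ball.
      have hin : inner ℝ e (-e) = -1 := by
        rw [inner_neg_right, real_inner_self_eq_norm_sq, he, one_pow]
      have h1 := eq_of_touching hn hα0 hC hc₀ hGinc hu he hx (hueq x hxm)
        (by rw [heq]; exact hueq _ (hmem he ht0.le hx hxm)) heq.symm hnonneg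
        (y := -e) (by rw [hin]; exact ht)
      rw [huout (-e) (by rw [mem_ball_zero_iff, norm_neg, he]; exact lt_irrefl _)] at h1
      refine (hupos _ ?_).ne' h1
      rw [mem_ball_zero_iff]
      have := norm_planeReflection_lt he ht0 (hin.trans_lt ht)
      rwa [norm_neg, he] at this
    · rw [huout x (by rw [mem_ball_zero_iff, hx1]; exact lt_irrefl _)]
      refine hupos _ ?_
      rw [mem_ball_zero_iff, ← hx1]
      exact norm_planeReflection_lt he ht0 hx
  have hmove : ∀ e : EuclideanSpace ℝ (Fin n), ‖e‖ = 1 → ∀ t ∈ Set.Icc (-1 : ℝ) 0,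
      ∀ z, inner ℝ e z < t → u z ≤ u (planeReflection e t z) := by
    intro e he
    refine le_planeReflection_of_continuation hu hnn huout he hδ ?_ (hstrong e he)
    intro t ht x hxb hx hneg hmin
    refine hδmin e x t _ _ he hx (hueq x hxb) (hueq _ (hmem he ht hx hxb)) hneg hmin ?_
    have h1 := hK.dist_le_mul (u (planeReflection e t x)) (u x)
    rw [Real.dist_eq, Real.dist_eq, abs_of_neg (sub_neg.2 hneg)] at h1
    linarith [neg_abs_le (f (u (planeReflection e t x)) - f (u x))]
  have hrad : ∀ x y : EuclideanSpace ℝ (Fin n), ‖x‖ = ‖y‖ → u x = u y := fun x y hxy =>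
    eq_of_norm_eq_of_le_planeReflection
      (fun e he => hmove e he 0 ⟨by norm_num, le_rfl⟩) hxy
  have : Nonempty (Fin n) := ⟨⟨0, hn⟩⟩
  obtain ⟨e, he⟩ := exists_norm_eq (EuclideanSpace ℝ (Fin n)) zero_le_one
  refine ⟨fun r => u (r • e), fun x => hrad _ _ ?_, ?_⟩
  · rw [norm_smul, he, mul_one, norm_norm]
  · intro r hr s hs hrs
    have hin : inner ℝ e (-s • e) = -s := by
      rw [inner_smul_right, real_inner_self_eq_norm_sq, he, one_pow, mul_one]
    have hns : ‖-s • e‖ = s := by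
      rw [norm_smul, he, mul_one, norm_neg, Real.norm_of_nonneg hs.1]
    -- The plane midway between `-s • e` and `-r • e` exchanges them. Strictness on the closed ball
    -- covers `s = 1`.
    have h1 := hstrong e he (-((r + s) / 2)) (by linarith [hs.2]) (by linarith [hr.1])
      (hmove e he _ ⟨by linarith [hs.2], by linarith [hr.1]⟩) (-s • e)
      (by rw [mem_closedBall_zero_iff, hns]; exact hs.2) (by rw [hin]; linarith)
    have h2 : planeReflection e (-((r + s) / 2)) (-s • e) = -r • e := by
      rw [planeReflection, hin, ← add_smul]
      congr 1
      ring
    rw [h2] at h1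
    have h3 : u (-r • e) = u (r • e) := hrad _ _ (by rw [neg_smul, norm_neg])
    have h4 : u (-s • e) = u (s • e) := hrad _ _ (by rw [neg_smul, norm_neg])
    simpa only [h3, h4] using h1
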